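/- Let $\{\mathcal H_k\}_{k\ge 0}$ be a concave increasing sequence of real numbers, meaning that $\mathcal H_k=\sum_{i=1}^k h_i$ for all $k\ge 0$ (so $\mathcal H_0=0$), for some monotone (weakly) decreasing sequence $h_1\ge h_2\ge\cdots$ of positive real numbers. Let $n$ and $T$ be integers with $0\le n\le T-1$ and $T\ge 3$. Then $$\sum_{s=1}^{T-1}(-1)^{s+1}R_n(s,T)\,\mathcal H_s<\sum_{s=1}^{T-1}\mathcal H_s .$$ Here $R_n(s,T)=R_n(s(s+1);0,0,T,-T)$, where $R_n(x;\alpha,\beta,\gamma,\delta)$ is the Racah polynomial $$R_n\bigl(s(s+\gamma+\delta+1);\alpha,\beta,\gamma,\delta\bigr)={}_4F_3\left(\begin{matrix}-n,\ n+\alpha+\beta+1,\ -s,\ s+\gamma+\delta+1\\ \alpha+1,\ \beta+\delta+1,\ \gamma+1\end{matrix}\,\middle|\,1\right);$$ explicitly, with $(a)_k=a(a+1)\cdots(a+k-1)$, $$R_n(s,T)=\sum_{k=0}^{n}\frac{(-n)_k\,(n+1)_k\,(-s)_k\,(s+1)_k}{(1)_k\,(1-T)_k\,(1+T)_k\,k!}.$$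 -/

import Mathlib

noncomputable section

/-- The terminating generalized hypergeometric series
`₄F₃(-n, a₂, a₃, a₄; b₁, b₂, b₃ | z) = ∑ₖ (-n)ₖ(a₂)ₖ(a₃)ₖ(a₄)ₖ / ((b₁)ₖ(b₂)ₖ(b₃)ₖ) * zᵏ/k!`,
where `(a)ₖ = a(a+1)⋯(a+k-1)`.  Since `(-n)ₖ = 0` for `k > n`, the sum runs over `0 ≤ k ≤ n`;
it is meant for lower parameters with `(bᵢ)ₖ ≠ 0` for all `k ≤ n`. -/
def terminating4F3 (n : ℕ) (a₂ a₃ a₄ b₁ b₂ b₃ z : ℝ) : ℝ :=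
  ∑ k ∈ Finset.range (n + 1),
    ((ascPochhammer ℝ k).eval (-(n : ℝ)) * (ascPochhammer ℝ k).eval a₂ *
        (ascPochhammer ℝ k).eval a₃ * (ascPochhammer ℝ k).eval a₄) /
      ((ascPochhammer ℝ k).eval b₁ * (ascPochhammer ℝ k).eval b₂ *
        (ascPochhammer ℝ k).eval b₃) *
      (z ^ k / (k.factorial : ℝ))

/-- The value `Rₙ(s(s+γ+δ+1); α, β, γ, δ)` of the Racah polynomial of degree `n`, written as a
function of the parameter `s`. -/
def racahValue (n : ℕ) (α β γ δ s : ℝ) : ℝ :=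
  terminating4F3 n (n + α + β + 1) (-s) (s + γ + δ + 1) (α + 1) (β + δ + 1) (γ + 1) 1

/-- `Rₙ(s, T) = Rₙ(s(s+1); 0, 0, T, -T)`. -/
def racahR (n s T : ℕ) : ℝ :=
  racahValue n 0 0 (T : ℝ) (-(T : ℝ)) (s : ℝ)

/-- `H` is concave increasing if `H k = h 1 + ⋯ + h k` for some (weakly) decreasing sequence
`h 1 ≥ h 2 ≥ ⋯` of positive reals; in particular `H 0 = 0`. -/
def IsConcaveIncreasing (H : ℕ → ℝ) : Prop :=
  ∃ h : ℕ → ℝ, (∀ i, 1 ≤ i → 0 < h i) ∧ AntitoneOn h (Set.Ici 1) ∧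
    ∀ k, H k = ∑ i ∈ Finset.Icc 1 k, h i

end

/-!
It suffices to prove `|Rₙ(s, T)| ≤ 1` for `n, s < T`. The `T`-dimensional irreducible representation
`V` of `𝔰𝔩₂` decomposes `End V` into spherical tensor operators of rank `n < T`. The squares of the
matrix elements of the normalized tensor operators of rank `n` form a nonnegative `T × T` matrix,
which satisfies the three-term recurrence in `n` of the Racah polynomials with the Casimir operator
on diagonal matrices in place of its eigenvalue `-s (s + 1)`. The eigenvectors of that operator are
the discrete Chebyshev polynomials, so they are also eigenvectors of the nonnegative matrix, with
eigenvalue `Rₙ(s, T)`. The constant eigenvector, `s = 0`, has eigenvalue `1`: the matrix is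
stochastic, and its eigenvalues have absolute value at most `1`.

Strictness comes from the term `s = 1` if `0 < n`, because `Rₙ(1, T) = 1 - 2 n (n + 1) / (T² - 1)`,
and from the negative term `s = 2` if `n = 0`.
-/

section FwdDiff

variable {R : Type*} [CommRing R]

theorem fwdDiff_iter_affine_mul (f : R → R) (c d h : R) (k : ℕ) (x : R) :
    (fwdDiff h)^[k] (fun y => (c * y + d) * f y) x =
      (c * (x + k * h) + d) * (fwdDiff h)^[k] f x + c * k * h * (fwdDiff h)^[k - 1] f x := by
  induction k generalizing x with
  | zero => simp
  | succ k ih =>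
    rw [Function.iterate_succ_apply', fwdDiff, ih, ih, Function.iterate_succ_apply', fwdDiff]
    rcases k with _ | k
    · simp only [Nat.add_sub_cancel, Nat.zero_sub, Function.iterate_zero, id_eq]
      push_cast
      ring
    · simp only [Nat.add_sub_cancel, Function.iterate_succ_apply' _ k, fwdDiff]
      push_cast
      ring

theorem fwdDiff_iter_quadratic_mul (f : R → R) (p q h : R) (k : ℕ) (x : R) :
    (fwdDiff h)^[k] (fun y => (y + p) * (q - y) * f y) x =
      (x + k * h + p) * (q - (x + k * h)) * (fwdDiff h)^[k] f x +
        k * h * (q - p - 2 * (x + k * h) + h) * (fwdDiff h)^[k - 1] f x -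
        k * (k - 1) * h ^ 2 * (fwdDiff h)^[k - 2] f x := by
  have factor : (fun y => (y + p) * (q - y) * f y) =
      fun y => (1 * y + p) * ((fun z => (-1 * z + q) * f z) y) := by
    ext y
    ring
  simp only [factor, fwdDiff_iter_affine_mul]
  rcases k with _ | k
  · push_cast
    ring
  · rw [show k + 1 - 2 = k - 1 by omega, Nat.add_sub_cancel]
    push_cast
    ring

end FwdDiff

section TensorOperators

variable {R : Type*} [CommRing R]

/-- The squared matrix element `x (τ - x)`, between the `x`-th and the `(x - 1)`-st weight vector,
of the lowering operator of the `τ`-dimensional irreducible representation of `𝔰𝔩₂`. -/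
def ladderCoeff (τ x : R) : R := x * (τ - x)

/-- The matrix elements of the `n`-th power of the raising operator, that is, of the extremal
component of the spherical tensor operator of rank `n`. -/
def ladderProd (τ : R) (n : ℕ) (x : R) : R := ∏ j ∈ Finset.range n, ladderCoeff τ (x - j)

/-- The matrix elements of the components of the spherical tensor operator of rank `n`, up to
normalization. Commuting `k` times with the lowering operator amounts to a `k`-fold forward
difference (a discrete Rodrigues formula); the resulting component maps the weight `x` to the weight
`x + k - n`. For `k = n` it is diagonal, and the diagonal is the discrete Chebyshev polynomial. -/
def tensorElt (τ : R) (n k : ℕ) (x : R) : R := (fwdDiff (1 : R))^[k] (ladderProd τ n) x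

theorem tensorElt_zero_right (τ : R) (n : ℕ) (x : R) : tensorElt τ n 0 x = ladderProd τ n x := rfl

theorem tensorElt_succ (τ : R) (n k : ℕ) (x : R) :
    tensorElt τ n (k + 1) x = tensorElt τ n k (x + 1) - tensorElt τ n k x := by
  simp only [tensorElt, Function.iterate_succ_apply', fwdDiff]

theorem ladderProd_succ (τ : R) (n : ℕ) (x : R) :
    ladderProd τ (n + 1) x = ladderProd τ n x * ladderCoeff τ (x - n) := by
  rw [ladderProd, Finset.prod_range_succ, ← ladderProd]

theorem ladderProd_succ_add_one (τ : R) (n : ℕ) (x : R) :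
    ladderProd τ (n + 1) (x + 1) = ladderCoeff τ (x + 1) * ladderProd τ n x := by
  rw [ladderProd, Finset.prod_range_succ', Nat.cast_zero, sub_zero, mul_comm]
  congr 1
  refine Finset.prod_congr rfl fun j _ => ?_
  rw [Nat.cast_succ, add_sub_add_right_eq_sub]

theorem fwdDiff_ladderProd_succ (τ : R) (n : ℕ) (x : R) :
    fwdDiff (1 : R) (ladderProd τ (n + 1)) x =
      (n + 1) * (τ - 2 * x - 1 + n) * ladderProd τ n x := by
  rw [fwdDiff, ladderProd_succ_add_one, ladderProd_succ, ladderCoeff, ladderCoeff]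
  ring

/-- The discrete Pearson equation of the weight `ladderProd τ n`. -/
theorem mul_fwdDiff_ladderProd (τ : R) (n : ℕ) (x : R) :
    (x + (1 - n)) * ((τ - 1 + n) - x) * fwdDiff (1 : R) (ladderProd τ n) x =
      n * (τ - 2 * x - 2 + n) * ladderProd τ n x := by
  rcases n with _ | n
  · simp [ladderProd, fwdDiff]
  · rw [fwdDiff_ladderProd_succ, ladderProd_succ, ladderCoeff]
    push_cast
    ring

theorem tensorElt_succ_succ (τ : R) (n k : ℕ) (x : R) :
    tensorElt τ (n + 1) (k + 1) x =
      (n + 1) * ((τ - 2 * (x + k) - 1 + n) * tensorElt τ n k x -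
        2 * k * tensorElt τ n (k - 1) x) := by
  have affine : fwdDiff (1 : R) (ladderProd τ (n + 1)) =
      fun y => ((-2 * (n + 1)) * y + (n + 1) * (τ - 1 + n)) * ladderProd τ n y := by
    ext y
    rw [fwdDiff_ladderProd_succ]
    ring
  rw [tensorElt, Function.iterate_succ_apply, affine, fwdDiff_iter_affine_mul, ← tensorElt,
    ← tensorElt]
  ring

/-- The Casimir operator acts on tensor operators of rank `n` by `n (n + 1)`: this is the `k`-th
difference of the Pearson equation. -/
theorem tensorElt_casimir (τ : R) (n k : ℕ) (x : R) :
    ladderCoeff τ (x + k + 1 - n) * tensorElt τ n (k + 1) x =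
      ((n - k) * (τ - 1 - 2 * (x + k - n)) - n * (n + 1)) * tensorElt τ n k x -
        k * (2 * n + 1 - k) * tensorElt τ n (k - 1) x := by
  have pearson : (fun y => (y + (1 - n)) * ((τ - 1 + n) - y) * fwdDiff (1 : R) (ladderProd τ n) y) =
      fun y => ((-2 * n) * y + n * (τ - 2 + n)) * ladderProd τ n y := by
    ext y
    rw [mul_fwdDiff_ladderProd]
    ring
  have differenced := congrArg (fun F => (fwdDiff (1 : R))^[k] F x) pearson
  simp only [fwdDiff_iter_quadratic_mul, fwdDiff_iter_affine_mul,
    ← Function.iterate_succ_apply] at differenced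
  unfold tensorElt ladderCoeff
  rcases k with _ | _ | k
  · push_cast at differenced ⊢
    linear_combination differenced
  · simp only [zero_add, Nat.sub_self] at differenced ⊢
    push_cast at differenced ⊢
    linear_combination differenced
  · simp only [Nat.add_sub_cancel, Nat.succ_eq_add_one, show k + 1 + 1 - 2 = k by omega]
      at differenced ⊢
    push_cast at differenced ⊢
    linear_combination differenced

theorem tensorElt_eq_zero_of_lt (τ : R) {n k : ℕ} (h : 2 * n < k) (x : R) :
    tensorElt τ n k x = 0 := by
  obtain ⟨k, rfl⟩ := Nat.exists_eq_add_one_of_ne_zero (Nat.ne_zero_of_lt h)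
  induction n generalizing k with
  | zero =>
    have const : fwdDiff (1 : R) (ladderProd τ 0) = 0 := by
      ext y
      simp [ladderProd, fwdDiff]
    rw [tensorElt, Function.iterate_succ_apply, const,
      Function.iterate_fixed (by ext y; simp [fwdDiff]), Pi.zero_apply]
  | succ n ih =>
    obtain ⟨j, rfl⟩ : ∃ j, k = j + 1 + 1 := ⟨k - 2, by omega⟩
    rw [tensorElt_succ_succ, ih _ (by omega), show j + 1 + 1 - 1 = j + 1 from rfl, ih _ (by omega)]
    ring

theorem tensorElt_natCast_of_lt (τ : R) {n k b : ℕ} (h : b + k < n) :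
    tensorElt τ n k (b : R) = 0 := by
  induction k generalizing b with
  | zero => exact Finset.prod_eq_zero (Finset.mem_range.2 h) (by simp [ladderCoeff])
  | succ k ih =>
    rw [tensorElt_succ, ← Nat.cast_add_one, ih (by omega), ih (by omega), sub_zero]

theorem tensorElt_natCast_of_add_eq (τ : R) {n k b : ℕ} (h : b + k = n) :
    tensorElt τ n k (b : R) = ladderProd τ n n := by
  induction k generalizing b with
  | zero => rw [tensorElt_zero_right, ← h, add_zero]
  | succ k ih =>
    rw [tensorElt_succ, ← Nat.cast_add_one, ih (by omega), tensorElt_natCast_of_lt τ (by omega),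
      sub_zero]

/-- The coefficient `x (τ² - x²)` of the three-term recurrences in the rank. -/
def rankCoeff (τ x : R) : R := x * (τ ^ 2 - x ^ 2)

theorem rankCoeff_mul_tensorElt (τ : R) (n k : ℕ) (x : R) :
    rankCoeff τ (n + 1) * tensorElt τ n k x =
      2 * (2 * n + 2 - k) * tensorElt τ (n + 1) k x +
        (τ + 1 - 2 * (x + k - n) + n) * tensorElt τ (n + 1) (k + 1) x := by
  rw [rankCoeff, tensorElt_succ_succ]
  rcases k with _ | k
  · simp only [tensorElt_zero_right]
    rw [ladderProd_succ, ladderCoeff]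
    push_cast
    ring
  · have casimir := tensorElt_casimir τ n k x
    rw [ladderCoeff] at casimir
    rw [tensorElt_succ_succ, Nat.add_sub_cancel]
    push_cast at casimir ⊢
    linear_combination (4 * (n + 1)) * casimir

end TensorOperators

section JacobiOperator

variable {R : Type*} [CommRing R]

/-- The Casimir operator on diagonal matrices: a second-order difference operator with eigenvalues
`-s (s + 1)` on the interval `0, …, τ - 1`. The value `f (0 - 1)` is multiplied by
`ladderCoeff τ 0 = 0`. -/
def jacobiOp (τ : R) (f : ℕ → R) (a : ℕ) : R :=
  ladderCoeff τ (a + 1) * (f (a + 1) - f a) - ladderCoeff τ a * (f a - f (a - 1))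

theorem sum_mul_jacobiOp_comm (T : ℕ) (f g : ℕ → R) :
    ∑ a ∈ Finset.range T, f a * jacobiOp (T : R) g a =
      ∑ a ∈ Finset.range T, jacobiOp (T : R) f a * g a := by
  let wronskian (a : ℕ) : R := ladderCoeff (T : R) a * (f (a - 1) * g a - f a * g (a - 1))
  rw [← sub_eq_zero, ← Finset.sum_sub_distrib]
  calc ∑ a ∈ Finset.range T, (f a * jacobiOp (T : R) g a - jacobiOp (T : R) f a * g a)
      = ∑ a ∈ Finset.range T, (wronskian (a + 1) - wronskian a) :=
        Finset.sum_congr rfl fun a _ => by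
          simp only [wronskian, jacobiOp, Nat.add_sub_cancel]
          push_cast
          ring
    _ = 0 := by
      rw [Finset.sum_range_sub]
      simp [wronskian, ladderCoeff]

theorem jacobiOp_tensorElt_self (τ : R) (s a : ℕ) :
    jacobiOp τ (fun i => tensorElt τ s s (i : R)) a =
      -(s * (s + 1)) * tensorElt τ s s (a : R) := by
  have pred : ladderCoeff τ a * tensorElt τ s s ((a - 1 : ℕ) : R) =
      ladderCoeff τ a * tensorElt τ s s ((a : R) - 1) := by
    rcases a with _ | a <;> simp [ladderCoeff]
  have up := tensorElt_casimir τ s s (a : R)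
  have down := tensorElt_casimir τ s s ((a : R) - 1)
  rw [tensorElt_succ, add_right_comm, add_sub_cancel_right] at up
  rw [tensorElt_succ, sub_add_cancel, add_right_comm, sub_add_cancel, add_sub_cancel_right] at down
  rw [jacobiOp, mul_sub _ (tensorElt τ s s (a : R)), pred]
  push_cast
  rcases s with _ | s
  · push_cast at up down ⊢
    linear_combination up - down
  · have diff := tensorElt_succ τ (s + 1) s ((a : R) - 1)
    rw [sub_add_cancel] at diff
    rw [Nat.add_sub_cancel] at up down
    push_cast at up down ⊢
    linear_combination up - down + (s + 1) * (s + 2) * diff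

theorem sum_tensorElt_mul_jacobiOp (T s : ℕ) (g : ℕ → R) :
    ∑ a ∈ Finset.range T, tensorElt (T : R) s s a * jacobiOp (T : R) g a =
      -(s * (s + 1)) * ∑ a ∈ Finset.range T, tensorElt (T : R) s s a * g a := by
  rw [sum_mul_jacobiOp_comm, Finset.mul_sum]
  refine Finset.sum_congr rfl fun a _ => ?_
  rw [jacobiOp_tensorElt_self, mul_assoc]

end JacobiOperator

noncomputable section TensorKernel

/-- The squared norm of the weight vector `a` when the lowering operator is normalized to map each
weight vector to the next one with coefficient `1`. -/
def ladderNorm (τ : ℝ) (a : ℕ) : ℝ := ∏ i ∈ Finset.range a, ladderCoeff τ (i + 1)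

/-- The normalization of the tensor operators of rank `n` that makes the columns of `tensorKernel`
sum to `1`. -/
def rankNorm (τ : ℝ) (n : ℕ) : ℝ := ∏ i ∈ Finset.range n, ((i + 1) * rankCoeff τ (i + 1))⁻¹

/-- The squared matrix elements, from the weight `b` to the weight `a`, of the normalized tensor
operators of rank `n`; only the component of order `k = n + a - b` contributes to this entry. -/
def tensorKernel (τ : ℝ) (n a b : ℕ) : ℝ :=
  if b ≤ n + a then
    rankNorm τ n * (ladderNorm τ a / ladderNorm τ b) *
      ((2 * n - (n + a - b)).factorial / (n + a - b).factorial) * tensorElt τ n (n + a - b) b ^ 2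
  else 0

theorem ladderNorm_succ (τ : ℝ) (a : ℕ) :
    ladderNorm τ (a + 1) = ladderNorm τ a * ladderCoeff τ (a + 1) :=
  Finset.prod_range_succ _ _

theorem ladderCoeff_pos {τ x : ℝ} (hx : 0 < x) (hτ : x < τ) : 0 < ladderCoeff τ x :=
  mul_pos hx (sub_pos.2 hτ)

theorem rankCoeff_pos {τ x : ℝ} (hx : 0 < x) (hτ : x < τ) : 0 < rankCoeff τ x :=
  mul_pos hx (sub_pos.2 (pow_lt_pow_left₀ hτ hx.le two_ne_zero))

variable {T n a b k : ℕ}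

theorem rankCoeff_natCast_add_one_pos (h : n + 1 < T) : 0 < rankCoeff (T : ℝ) (n + 1) :=
  rankCoeff_pos n.cast_add_one_pos (mod_cast h)

theorem ladderNorm_pos (h : a < T) : 0 < ladderNorm T a :=
  Finset.prod_pos fun i hi => ladderCoeff_pos i.cast_add_one_pos <| mod_cast
    (Nat.succ_le_of_lt (Finset.mem_range.1 hi)).trans_lt h

theorem rankNorm_nonneg (h : n < T) : 0 ≤ rankNorm T n :=
  Finset.prod_nonneg fun i hi => inv_nonneg.2 <| mul_nonneg i.cast_add_one_pos.le
    (rankCoeff_natCast_add_one_pos ((Nat.succ_le_of_lt (Finset.mem_range.1 hi)).trans_lt h)).le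

theorem rankNorm_succ_mul (h : n + 1 < T) :
    rankNorm T (n + 1) * ((n + 1) * rankCoeff (T : ℝ) (n + 1)) = rankNorm T n := by
  have := rankCoeff_natCast_add_one_pos h
  rw [rankNorm, Finset.prod_range_succ, ← rankNorm, inv_mul_cancel_right₀ (by positivity)]

theorem tensorKernel_nonneg (hn : n < T) (ha : a < T) (hb : b < T) : 0 ≤ tensorKernel T n a b := by
  have := rankNorm_nonneg hn
  have := ladderNorm_pos ha
  have := ladderNorm_pos hb
  rw [tensorKernel]
  split_ifs <;> positivity

theorem tensorKernel_of_add_eq (τ : ℝ) (h : k + b = n + a) :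
    tensorKernel τ n a b = rankNorm τ n * (ladderNorm τ a / ladderNorm τ b) *
      ((2 * n - k).factorial / k.factorial) * tensorElt τ n k b ^ 2 := by
  obtain rfl : k = n + a - b := by omega
  rw [tensorKernel, if_pos (by omega)]

theorem tensorKernel_of_lt (τ : ℝ) (h : n + a < b) : tensorKernel τ n a b = 0 :=
  if_neg h.not_ge

theorem tensorKernel_zero (hb : b < T) : tensorKernel T 0 a b = if a = b then 1 else 0 := by
  rcases lt_or_ge a b with h | h
  · rw [tensorKernel_of_lt _ (by omega), if_neg (by omega)]
  · obtain ⟨k, rfl⟩ := Nat.exists_eq_add_of_le h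
    rw [tensorKernel_of_add_eq (k := k) _ (by omega)]
    rcases k with _ | k
    · simp [rankNorm, tensorElt, ladderProd, (ladderNorm_pos hb).ne']
    · rw [tensorElt_eq_zero_of_lt _ (by omega), if_neg (by omega), zero_pow two_ne_zero, mul_zero]

theorem rankCoeff_mul_tensorKernel_succ_rank (hn : n + 1 < T) (h : k + b = n + a) :
    rankCoeff (T : ℝ) (n + 1) * tensorKernel T (n + 1) a b =
      rankNorm T n * (ladderNorm T a / ladderNorm T b) *
        ((2 * n + 1 - k).factorial / (k + 1).factorial) * ((n + 1) *
          ((T - 1 - 2 * a - n) * tensorElt (T : ℝ) n k b -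
            2 * k * tensorElt (T : ℝ) n (k - 1) b) ^ 2) := by
  have weight : (b : ℝ) + k = n + a := mod_cast (add_comm b k).trans h
  rw [tensorKernel_of_add_eq (k := k + 1) _ (by omega), tensorElt_succ_succ, weight,
    ← rankNorm_succ_mul hn, show 2 * (n + 1) - (k + 1) = 2 * n + 1 - k by omega]
  ring

theorem rankCoeff_mul_tensorKernel_pred_rank (hn : n < T) (h : k + b = n + a) :
    rankCoeff (T : ℝ) n * tensorKernel T (n - 1) a b =
      rankNorm T n * (ladderNorm T a / ladderNorm T b) *
        ((2 * n - 1 - k).factorial * k / k.factorial) * (n *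
          (2 * (2 * n + 1 - k) * tensorElt (T : ℝ) n (k - 1) b +
            (T - 1 - 2 * a + n + 1) * tensorElt (T : ℝ) n k b) ^ 2) := by
  rcases n with _ | n
  · simp [rankCoeff]
  rcases k with _ | k
  · simp [tensorKernel_of_lt _ (show n + a < b by omega)]
  have weight : (b : ℝ) + k = n + a := mod_cast (by omega : b + k = n + a)
  have lowered := rankCoeff_mul_tensorElt (T : ℝ) n k b
  rw [weight] at lowered
  have lowered' : 2 * (2 * ((n + 1 : ℕ) : ℝ) + 1 - (k + 1 : ℕ)) * tensorElt (T : ℝ) (n + 1) k b +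
      (T - 1 - 2 * a + (n + 1 : ℕ) + 1) * tensorElt (T : ℝ) (n + 1) (k + 1) b =
      rankCoeff (T : ℝ) (n + 1) * tensorElt (T : ℝ) n k b := by
    rw [lowered]
    push_cast
    ring
  rw [Nat.add_sub_cancel, Nat.add_sub_cancel, lowered',
    tensorKernel_of_add_eq (k := k) _ (by omega), ← rankNorm_succ_mul hn,
    show 2 * (n + 1) - 1 - (k + 1) = 2 * n - k by omega, Nat.factorial_succ]
  push_cast
  field_simp

theorem ladderCoeff_mul_tensorKernel_succ (h : k + b = n + a) :
    ladderCoeff (T : ℝ) (a + 1) * tensorKernel T n (a + 1) b =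
      rankNorm T n * (ladderNorm T a / ladderNorm T b) *
        ((2 * n - 1 - k).factorial / (k + 1).factorial) *
          (((n - k) * (T - 1 - 2 * a) - n * (n + 1)) * tensorElt (T : ℝ) n k b -
            k * (2 * n + 1 - k) * tensorElt (T : ℝ) n (k - 1) b) ^ 2 := by
  have weight : (b : ℝ) + k = n + a := mod_cast (add_comm b k).trans h
  have casimir := tensorElt_casimir (T : ℝ) n k b
  rw [weight, add_assoc, add_sub_cancel_left, add_sub_cancel_left] at casimir
  rw [← casimir, tensorKernel_of_add_eq (k := k + 1) _ (by omega), ladderNorm_succ,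
    show 2 * n - (k + 1) = 2 * n - 1 - k by omega]
  ring

theorem ladderCoeff_mul_tensorKernel_pred (h : k + b = n + a) :
    ladderCoeff (T : ℝ) a * tensorKernel T n (a - 1) b =
      rankNorm T n * (ladderNorm T a / ladderNorm T b) *
        ((2 * n + 1 - k).factorial * k / k.factorial) * tensorElt (T : ℝ) n (k - 1) b ^ 2 := by
  rcases a with _ | a
  · rcases k with _ | k
    · simp [ladderCoeff]
    · simp [ladderCoeff, tensorElt_natCast_of_lt (T : ℝ) (show b + k < n by omega)]
  rcases k with _ | k
  · simp [tensorKernel_of_lt _ (show n + a < b by omega)]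
  rw [Nat.add_sub_cancel, Nat.add_sub_cancel, tensorKernel_of_add_eq (k := k) _ (by omega),
    ladderNorm_succ, Nat.factorial_succ, show 2 * n + 1 - (k + 1) = 2 * n - k by omega]
  push_cast
  field_simp

theorem two_mul_jacobiOp (τ : ℝ) (f : ℕ → ℝ) (a : ℕ) :
    2 * jacobiOp τ f a = 2 * (ladderCoeff τ (a + 1) * f (a + 1) + ladderCoeff τ a * f (a - 1)) -
      (τ ^ 2 - 1 - (τ - 1 - 2 * a) ^ 2) * f a := by
  rw [jacobiOp, ladderCoeff, ladderCoeff]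
  ring

theorem tensorKernel_recurrence_of_lt (hn : n + 1 < T) (ha : a < T) (hb : b < T) (h : n + a < b) :
    rankCoeff (T : ℝ) (n + 1) * tensorKernel T (n + 1) a b +
        rankCoeff (T : ℝ) n * tensorKernel T (n - 1) a b =
      (2 * n + 1) * (((T : ℝ) ^ 2 - n ^ 2 - n - 1) * tensorKernel T n a b +
        2 * jacobiOp (T : ℝ) (fun i => tensorKernel T n i b) a) := by
  rw [two_mul_jacobiOp, tensorKernel_of_lt (n := n - 1) _ (by omega),
    tensorKernel_of_lt (a := a) _ h, tensorKernel_of_lt (n := n) (a := a - 1) _ (by omega)]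
  obtain h | rfl : n + a + 1 < b ∨ b = n + a + 1 := by omega
  · rw [tensorKernel_of_lt _ (by omega), tensorKernel_of_lt _ (by omega)]
    ring
  · have := (ladderNorm_pos ha).ne'
    have := (ladderNorm_pos hb).ne'
    rw [tensorKernel_of_add_eq (k := 0) _ (by omega), tensorKernel_of_add_eq (k := 0) _ (by omega),
      ladderNorm_succ _ a, ← rankNorm_succ_mul hn, tensorElt_zero_right, tensorElt_zero_right,
      ladderProd_succ, show ((n + a + 1 : ℕ) : ℝ) - n = a + 1 by push_cast; ring, Nat.sub_zero,
      Nat.sub_zero, show 2 * (n + 1) = 2 * n + 1 + 1 by ring, Nat.factorial_succ,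
      Nat.factorial_succ]
    push_cast
    field_simp
    ring

/-- Four squared ladder relations enter the recurrence of `tensorKernel`; the factorial weights are
what makes their cross terms `u * v` cancel. -/
theorem factorial_quadratic_identity (h : k < 2 * n) (N u v : ℝ) :
    ((2 * n + 1 - k).factorial / (k + 1).factorial : ℝ) *
          ((n + 1) * ((N - n) * u - 2 * k * v) ^ 2) +
        ((2 * n - 1 - k).factorial * k / k.factorial) *
          (n * (2 * (2 * n + 1 - k) * v + (N + n + 1) * u) ^ 2) =
      (2 * n + 1) * ((N ^ 2 - n ^ 2 - n) * ((2 * n - k).factorial / k.factorial) * u ^ 2 +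
        2 * ((2 * n - 1 - k).factorial / (k + 1).factorial *
            (((n - k) * N - n * (n + 1)) * u - k * (2 * n + 1 - k) * v) ^ 2 +
          (2 * n + 1 - k).factorial * k / k.factorial * v ^ 2)) := by
  obtain ⟨r, hr⟩ := Nat.exists_eq_add_of_lt h
  have hn : (n : ℝ) = (k + r + 1) / 2 := by
    rw [eq_div_iff two_ne_zero, mul_comm]
    exact_mod_cast hr
  rw [hr, show k + r + 1 + 1 - k = r + 1 + 1 by omega, show k + r + 1 - 1 - k = r by omega,
    show k + r + 1 - k = r + 1 by omega]
  simp only [Nat.factorial_succ, hn]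
  push_cast
  field_simp
  ring

theorem tensorKernel_recurrence_of_add_eq (hn : n + 1 < T) (h : k + b = n + a) :
    rankCoeff (T : ℝ) (n + 1) * tensorKernel T (n + 1) a b +
        rankCoeff (T : ℝ) n * tensorKernel T (n - 1) a b =
      (2 * n + 1) * (((T : ℝ) ^ 2 - n ^ 2 - n - 1) * tensorKernel T n a b +
        2 * jacobiOp (T : ℝ) (fun i => tensorKernel T n i b) a) := by
  rw [two_mul_jacobiOp, rankCoeff_mul_tensorKernel_succ_rank hn h,
    rankCoeff_mul_tensorKernel_pred_rank (by omega) h, ladderCoeff_mul_tensorKernel_succ h,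
    ladderCoeff_mul_tensorKernel_pred h, tensorKernel_of_add_eq _ h]
  have casimir := tensorElt_casimir (T : ℝ) n k b
  have weight : (b : ℝ) + k = n + a := mod_cast (add_comm b k).trans h
  rw [weight, add_sub_cancel_left] at casimir
  generalize rankNorm (T : ℝ) n * (ladderNorm T a / ladderNorm T b) = c
  generalize (T : ℝ) - 1 - 2 * a = N at *
  rcases lt_trichotomy k (2 * n) with hk | rfl | hk
  · linear_combination c * factorial_quadratic_identity hk N (tensorElt (T : ℝ) n k b)
      (tensorElt (T : ℝ) n (k - 1) b)
  · have annihilated : (n : ℝ) * (2 * tensorElt (T : ℝ) n (2 * n - 1) b +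
        (N + n + 1) * tensorElt (T : ℝ) n (2 * n) b) = 0 := by
      rw [tensorElt_eq_zero_of_lt _ (Nat.lt_succ_self (2 * n))] at casimir
      push_cast at casimir
      linear_combination casimir
    rw [Nat.add_sub_cancel_left, Nat.sub_self, show 2 * n - 1 - 2 * n = 0 by omega,
      Nat.factorial_succ (2 * n)]
    generalize tensorElt (T : ℝ) n (2 * n - 1) b = v at *
    generalize tensorElt (T : ℝ) n (2 * n) b = u at *
    rcases mul_eq_zero.1 annihilated with n_zero | v_eq
    · obtain rfl : n = 0 := mod_cast n_zero
      simp only [Nat.factorial]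
      push_cast
      ring
    · obtain rfl : v = -(N + n + 1) * u / 2 := by linarith
      simp only [Nat.factorial_zero, Nat.factorial_one]
      push_cast
      field_simp
      ring
  · rw [tensorElt_eq_zero_of_lt _ hk]
    rcases (Nat.succ_le_of_lt hk).lt_or_eq with hk | rfl
    · rw [tensorElt_eq_zero_of_lt _ (by omega)]
      ring
    · rw [Nat.succ_eq_add_one, Nat.sub_self, show 2 * n - 1 - (2 * n + 1) = 0 by omega,
        Nat.factorial_succ (2 * n + 1)]
      push_cast
      field_simp
      ring

theorem tensorKernel_recurrence (hn : n + 1 < T) (ha : a < T) (hb : b < T) :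
    rankCoeff (T : ℝ) (n + 1) * tensorKernel T (n + 1) a b +
        rankCoeff (T : ℝ) n * tensorKernel T (n - 1) a b =
      (2 * n + 1) * (((T : ℝ) ^ 2 - n ^ 2 - n - 1) * tensorKernel T n a b +
        2 * jacobiOp (T : ℝ) (fun i => tensorKernel T n i b) a) := by
  rcases lt_or_ge (n + a) b with h | h
  · exact tensorKernel_recurrence_of_lt hn ha hb h
  · exact tensorKernel_recurrence_of_add_eq hn (Nat.sub_add_cancel h)

end TensorKernel

noncomputable section RacahBasis

variable {R : Type*} [CommRing R]

/-- The Newton basis of the lattice `x (x + 1)`, of which the Racah polynomials with `α = β = 0` are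
linear combinations: it is the product of `i (i + 1) - x (x + 1)` over `i < k`. -/
def racahBasis (x : R) (k : ℕ) : R :=
  (ascPochhammer R k).eval (-x) * (ascPochhammer R k).eval (x + 1)

/-- The product of `i ^ 2 - x ^ 2` over `1 ≤ i ≤ k`, the counterpart of `racahBasis` centred at a
lattice point instead of a midpoint. -/
def centralBasis (x : R) (k : ℕ) : R :=
  (ascPochhammer R k).eval (1 - x) * (ascPochhammer R k).eval (1 + x)

theorem racahBasis_zero (x : R) : racahBasis x 0 = 1 := by simp [racahBasis]

theorem racahBasis_succ (x : R) (k : ℕ) :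
    racahBasis x (k + 1) = racahBasis x k * (k * (k + 1) - x * (x + 1)) := by
  rw [racahBasis, ascPochhammer_succ_eval, ascPochhammer_succ_eval, racahBasis]
  ring

theorem centralBasis_zero (x : R) : centralBasis x 0 = 1 := by simp [centralBasis]

theorem centralBasis_succ (x : R) (k : ℕ) :
    centralBasis x (k + 1) = centralBasis x k * ((k + 1) ^ 2 - x ^ 2) := by
  rw [centralBasis, ascPochhammer_succ_eval, ascPochhammer_succ_eval, centralBasis]
  ring

theorem racahBasis_natCast_of_lt {n k : ℕ} (h : n < k) : racahBasis (n : R) k = 0 := by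
  rw [racahBasis, ascPochhammer_eval_neg_coe_nat_of_lt h, zero_mul]

theorem add_one_mul_centralBasis_add_one (x : R) (k : ℕ) :
    (x + 1) * centralBasis (x + 1) k = (x + 1 + k) * racahBasis x k := by
  induction k with
  | zero => simp [centralBasis_zero, racahBasis_zero]
  | succ k ih =>
    rw [centralBasis_succ, racahBasis_succ, ← mul_assoc, ih]
    push_cast
    ring

theorem mul_centralBasis (x : R) (k : ℕ) :
    x * centralBasis x k = (x - k) * racahBasis x k := by
  induction k with
  | zero => simp [centralBasis_zero, racahBasis_zero]
  | succ k ih =>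
    rw [centralBasis_succ, racahBasis_succ, ← mul_assoc, ih]
    push_cast
    ring

theorem racahBasis_succ_sub (x : R) (k : ℕ) :
    racahBasis x (k + 1) - racahBasis (x - 1) (k + 1) = -2 * (k + 1) * x * centralBasis x k := by
  have right := add_one_mul_centralBasis_add_one (x - 1) k
  have left := mul_centralBasis x k
  rw [sub_add_cancel] at right
  rw [racahBasis_succ, racahBasis_succ]
  linear_combination (x + 1 + k) * left - (x - 1 - k) * right

theorem racahBasis_recurrence (τ x : R) (k : ℕ) :
    rankCoeff τ (x + 1) * racahBasis (x + 1) (k + 1) +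
        rankCoeff τ x * racahBasis (x - 1) (k + 1) =
      (2 * x + 1) * ((τ ^ 2 - x ^ 2 - x - 1 - 2 * (k + 1) * (k + 2)) * racahBasis x (k + 1) +
        2 * (k + 1) ^ 2 * ((k + 1) ^ 2 - τ ^ 2) * racahBasis x k) := by
  have forward := racahBasis_succ_sub (x + 1) k
  have backward := racahBasis_succ_sub x k
  have right := add_one_mul_centralBasis_add_one x k
  have left := mul_centralBasis x k
  rw [add_sub_cancel_right] at forward
  rw [rankCoeff, rankCoeff, racahBasis_succ x]
  rw [racahBasis_succ x] at forward backward
  linear_combination (x + 1) * (τ ^ 2 - (x + 1) ^ 2) * forward -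
    x * (τ ^ 2 - x ^ 2) * backward -
    2 * (k + 1) * (x + 1) * (τ ^ 2 - (x + 1) ^ 2) * right +
    2 * (k + 1) * x * (τ ^ 2 - x ^ 2) * left

end RacahBasis

noncomputable section RacahPolynomial

/-- The `k`-th term of the hypergeometric series of the Racah polynomial `Rₓ(y)`, arranged so that
its symmetry in the degree `x` and the variable `y` is visible. -/
def racahTerm (τ x y : ℝ) (k : ℕ) : ℝ :=
  racahBasis x k * racahBasis y k / ((k.factorial : ℝ) ^ 2 * centralBasis τ k)

theorem racahTerm_zero (τ x y : ℝ) : racahTerm τ x y 0 = 1 := by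
  simp [racahTerm, racahBasis_zero, centralBasis_zero]

theorem racahTerm_comm (τ x y : ℝ) (k : ℕ) : racahTerm τ x y k = racahTerm τ y x k := by
  rw [racahTerm, mul_comm (racahBasis x k), ← racahTerm]

theorem racahTerm_natCast_of_lt (τ y : ℝ) {n k : ℕ} (h : n < k) : racahTerm τ n y k = 0 := by
  rw [racahTerm, racahBasis_natCast_of_lt h, zero_mul, zero_div]

theorem racahTerm_recurrence {τ : ℝ} (x y : ℝ) {k : ℕ} (hτ : ((k : ℝ) + 1) ^ 2 - τ ^ 2 ≠ 0) :
    rankCoeff τ (x + 1) * racahTerm τ (x + 1) y (k + 1) +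
        rankCoeff τ x * racahTerm τ (x - 1) y (k + 1) =
      (2 * x + 1) * ((τ ^ 2 - x ^ 2 - x - 1 - 2 * (k + 1) * (k + 2)) * racahTerm τ x y (k + 1) +
        2 * (k * (k + 1) - y * (y + 1)) * racahTerm τ x y k) := by
  have lowered : 2 * (k * (k + 1) - y * (y + 1)) * racahTerm τ x y k =
      2 * (k + 1) ^ 2 * ((k + 1) ^ 2 - τ ^ 2) * racahBasis x k *
        (racahBasis y (k + 1) / (((k + 1).factorial : ℝ) ^ 2 * centralBasis τ (k + 1))) := by
    rw [racahTerm, racahBasis_succ y, centralBasis_succ, Nat.factorial_succ]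
    push_cast
    field_simp
  rw [lowered, racahTerm, racahTerm, racahTerm]
  linear_combination racahBasis y (k + 1) /
    (((k + 1).factorial : ℝ) ^ 2 * centralBasis τ (k + 1)) * racahBasis_recurrence τ x k

theorem sum_racahTerm_recurrence {τ : ℝ} (x y : ℝ) (m : ℕ)
    (hτ : ∀ k < m, ((k : ℝ) + 1) ^ 2 - τ ^ 2 ≠ 0) :
    rankCoeff τ (x + 1) * ∑ k ∈ Finset.range (m + 1), racahTerm τ (x + 1) y k +
        rankCoeff τ x * ∑ k ∈ Finset.range (m + 1), racahTerm τ (x - 1) y k =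
      (2 * x + 1) * ((τ ^ 2 - x ^ 2 - x - 1 - 2 * (y * (y + 1))) *
          ∑ k ∈ Finset.range (m + 1), racahTerm τ x y k -
        2 * (m * (m + 1) - y * (y + 1)) * racahTerm τ x y m) := by
  induction m with
  | zero =>
    simp only [zero_add, Finset.sum_range_one, racahTerm_zero, rankCoeff]
    push_cast
    ring
  | succ m ih =>
    have summed := ih fun k hk => hτ k (by omega)
    have term := racahTerm_recurrence x y (hτ m m.lt_succ_self)
    simp only [Finset.sum_range_succ _ (m + 1)]
    push_cast
    linear_combination summed + term

theorem racahR_eq_sum {n m : ℕ} (s T : ℕ) (h : n < m) :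
    racahR n s T = ∑ k ∈ Finset.range m, racahTerm T n s k := by
  rw [racahR, racahValue, terminating4F3]
  refine (Finset.sum_congr rfl fun k _ => ?_).trans <| Finset.sum_subset
    (Finset.range_mono (Nat.succ_le_of_lt h)) fun k _ hk =>
      racahTerm_natCast_of_lt T s (by simpa using hk)
  rw [racahTerm, racahBasis, racahBasis, centralBasis, zero_add, ascPochhammer_eval_one, one_pow,
    add_zero, add_zero, zero_add, neg_add_eq_sub, add_comm (T : ℝ) 1, add_neg_cancel_right]
  ring

theorem racahR_comm (n s T : ℕ) : racahR n s T = racahR s n T := by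
  rw [racahR_eq_sum s T (show n < n + s + 1 by omega),
    racahR_eq_sum n T (show s < n + s + 1 by omega)]
  exact Finset.sum_congr rfl fun k _ => racahTerm_comm T n s k

theorem racahR_zero_left (s T : ℕ) : racahR 0 s T = 1 := by
  rw [racahR_eq_sum s T zero_lt_one, Finset.sum_range_one, racahTerm_zero]

theorem racahR_zero_right (n T : ℕ) : racahR n 0 T = 1 := by
  rw [racahR_comm, racahR_zero_left]

theorem racahR_one_left (s T : ℕ) :
    racahR 1 s T = 1 - 2 * (s * (s + 1)) / ((T : ℝ) ^ 2 - 1) := by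
  have flip : (T : ℝ) ^ 2 - 1 = -(1 - (T : ℝ) ^ 2) := by ring
  rw [racahR_eq_sum s T (Nat.lt_add_one 1), Finset.sum_range_succ, Finset.sum_range_one,
    racahTerm_zero, racahTerm, racahBasis_succ, racahBasis_succ, centralBasis_succ,
    racahBasis_zero, racahBasis_zero, centralBasis_zero, flip, div_neg]
  push_cast
  ring

theorem racahR_recurrence {n T : ℕ} (s : ℕ) (hn : n + 1 < T) :
    rankCoeff (T : ℝ) (n + 1) * racahR (n + 1) s T + rankCoeff (T : ℝ) n * racahR (n - 1) s T =
      (2 * n + 1) * (((T : ℝ) ^ 2 - n ^ 2 - n - 1 - 2 * (s * (s + 1))) * racahR n s T) := by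
  have denominators (k : ℕ) (hk : k < n + 1) : ((k : ℝ) + 1) ^ 2 - (T : ℝ) ^ 2 ≠ 0 :=
    (sub_neg.2 (pow_lt_pow_left₀ (mod_cast (by omega)) k.cast_add_one_pos.le two_ne_zero)).ne
  have summed := sum_racahTerm_recurrence (n : ℝ) s (n + 1) denominators
  have pred : rankCoeff (T : ℝ) n * racahR (n - 1) s T =
      rankCoeff (T : ℝ) n * ∑ k ∈ Finset.range (n + 1 + 1), racahTerm T (n - 1) s k := by
    rcases n with _ | n
    · simp [rankCoeff]
    · rw [racahR_eq_sum s T (show n + 1 - 1 < n + 1 + 1 + 1 by omega)]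
      push_cast [Nat.add_sub_cancel]
      rw [add_sub_cancel_right]
  rw [racahTerm_natCast_of_lt _ _ n.lt_succ_self, mul_zero, sub_zero] at summed
  rw [pred, racahR_eq_sum s T (n + 1).lt_succ_self,
    racahR_eq_sum s T (show n < n + 1 + 1 by omega), Nat.cast_succ, summed]

theorem eq_racahR_mul_of_recurrence {T s : ℕ} {m : ℕ → ℝ}
    (hm : ∀ n, n + 1 < T → rankCoeff (T : ℝ) (n + 1) * m (n + 1) + rankCoeff (T : ℝ) n * m (n - 1) =
      (2 * n + 1) * (((T : ℝ) ^ 2 - n ^ 2 - n - 1 - 2 * (s * (s + 1))) * m n))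
    {n : ℕ} (hn : n < T) : m n = racahR n s T * m 0 := by
  induction n using Nat.strong_induction_on with
  | _ n ih =>
    rcases n with _ | n
    · rw [racahR_zero_left, one_mul]
    · refine mul_left_cancel₀ (rankCoeff_natCast_add_one_pos hn).ne' ?_
      have current := ih n n.lt_succ_self (by omega)
      have previous := ih (n - 1) (by omega) (by omega)
      have recurrence := hm n hn
      rw [current, previous] at recurrence
      linear_combination recurrence - m 0 * racahR_recurrence s hn

end RacahPolynomial

section Stochastic

theorem abs_le_one_of_sum_mul_eq_mul {ι R : Type*} [Ring R] [LinearOrder R] [IsStrictOrderedRing R]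
    {S : Finset ι} {K : ι → ι → R} {v : ι → R} {c : R} (K_nonneg : ∀ i ∈ S, ∀ j ∈ S, 0 ≤ K i j)
    (column_sum : ∀ j ∈ S, ∑ i ∈ S, K i j = 1)
    (eigen : ∀ j ∈ S, ∑ i ∈ S, v i * K i j = c * v j) (v_ne_zero : ∃ i ∈ S, v i ≠ 0) :
    |c| ≤ 1 := by
  obtain ⟨i₀, hi₀, v_i₀⟩ := v_ne_zero
  obtain ⟨j, hj, maximal⟩ := S.exists_max_image (fun i => |v i|) ⟨i₀, hi₀⟩
  refine le_of_mul_le_mul_right ?_ ((abs_pos.2 v_i₀).trans_le (maximal i₀ hi₀))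
  calc |c| * |v j| = |∑ i ∈ S, v i * K i j| := by rw [eigen j hj, abs_mul]
    _ ≤ ∑ i ∈ S, |v i * K i j| := S.abs_sum_le_sum_abs _
    _ ≤ ∑ i ∈ S, |v j| * K i j := Finset.sum_le_sum fun i hi => by
        rw [abs_mul, abs_of_nonneg (K_nonneg i hi j hj)]
        exact mul_le_mul_of_nonneg_right (maximal i hi) (K_nonneg i hi j hj)
    _ = 1 * |v j| := by rw [← Finset.mul_sum, column_sum j hj, mul_one, one_mul]

end Stochastic

section RacahBound

variable {n s T b : ℕ}

theorem sum_tensorElt_mul_tensorKernel (hn : n < T) (hb : b < T) :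
    ∑ a ∈ Finset.range T, tensorElt (T : ℝ) s s a * tensorKernel T n a b =
      racahR n s T * tensorElt (T : ℝ) s s b := by
  let moment (n : ℕ) : ℝ := ∑ a ∈ Finset.range T, tensorElt (T : ℝ) s s a * tensorKernel T n a b
  have moment_zero : moment 0 = tensorElt (T : ℝ) s s b := by
    simp [moment, tensorKernel_zero hb, hb]
  have moment_recurrence (n : ℕ) (hn : n + 1 < T) :
      rankCoeff (T : ℝ) (n + 1) * moment (n + 1) + rankCoeff (T : ℝ) n * moment (n - 1) =
        (2 * n + 1) * (((T : ℝ) ^ 2 - n ^ 2 - n - 1 - 2 * (s * (s + 1))) * moment n) := by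
    calc rankCoeff (T : ℝ) (n + 1) * moment (n + 1) + rankCoeff (T : ℝ) n * moment (n - 1)
        = ∑ a ∈ Finset.range T, (2 * n + 1) * (((T : ℝ) ^ 2 - n ^ 2 - n - 1) *
            (tensorElt (T : ℝ) s s a * tensorKernel T n a b) + 2 * (tensorElt (T : ℝ) s s a *
              jacobiOp (T : ℝ) (fun i => tensorKernel T n i b) a)) := by
          simp only [moment, Finset.mul_sum, ← Finset.sum_add_distrib]
          refine Finset.sum_congr rfl fun a ha => ?_
          linear_combination tensorElt (T : ℝ) s s a *
            tensorKernel_recurrence hn (Finset.mem_range.1 ha) hb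
      _ = (2 * n + 1) * (((T : ℝ) ^ 2 - n ^ 2 - n - 1) * moment n +
            2 * (-(s * (s + 1)) * moment n)) := by
          rw [← Finset.mul_sum, Finset.sum_add_distrib, ← Finset.mul_sum, ← Finset.mul_sum,
            sum_tensorElt_mul_jacobiOp]
      _ = _ := by ring
  rw [← moment_zero]
  exact eq_racahR_mul_of_recurrence moment_recurrence hn

theorem sum_tensorKernel (hn : n < T) (hb : b < T) :
    ∑ a ∈ Finset.range T, tensorKernel T n a b = 1 := by
  simpa only [racahR_zero_right, tensorElt_zero_right, ladderProd, Finset.range_zero,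
    Finset.prod_empty, one_mul] using sum_tensorElt_mul_tensorKernel (s := 0) hn hb

theorem tensorElt_self_zero_pos (hs : s < T) : 0 < tensorElt (T : ℝ) s s 0 := by
  have at_zero := tensorElt_natCast_of_add_eq (T : ℝ) (zero_add s)
  rw [Nat.cast_zero] at at_zero
  rw [at_zero]
  refine Finset.prod_pos fun j hj => ?_
  have hj := Finset.mem_range.1 hj
  rw [← Nat.cast_sub hj.le]
  exact ladderCoeff_pos (mod_cast Nat.sub_pos_of_lt hj) (mod_cast (Nat.sub_le s j).trans_lt hs)

theorem abs_racahR_le_one (hn : n < T) (hs : s < T) : |racahR n s T| ≤ 1 := by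
  refine abs_le_one_of_sum_mul_eq_mul (S := Finset.range T) (K := tensorKernel T n)
    (v := fun a => tensorElt (T : ℝ) s s a) ?_ ?_ ?_ ⟨0, ?_⟩
  · exact fun a ha b hb => tensorKernel_nonneg hn (Finset.mem_range.1 ha) (Finset.mem_range.1 hb)
  · exact fun b hb => sum_tensorKernel hn (Finset.mem_range.1 hb)
  · exact fun b hb => sum_tensorElt_mul_tensorKernel hn (Finset.mem_range.1 hb)
  · refine ⟨Finset.mem_range.2 (by omega), ?_⟩
    exact_mod_cast (tensorElt_self_zero_pos hs).ne'

theorem racahR_one_right_lt_one (hn : 0 < n) (hT : 1 < T) : racahR n 1 T < 1 := by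
  have hT : (0 : ℝ) < (T : ℝ) ^ 2 - 1 := sub_pos.2 (one_lt_pow₀ (mod_cast hT) two_ne_zero)
  rw [racahR_comm, racahR_one_left]
  exact sub_lt_self _ (by positivity)

end RacahBound

theorem IsConcaveIncreasing.pos {H : ℕ → ℝ} (hH : IsConcaveIncreasing H) {k : ℕ} (hk : 1 ≤ k) :
    0 < H k := by
  obtain ⟨h, h_pos, -, H_eq⟩ := hH
  rw [H_eq]
  exact Finset.sum_pos (fun i hi => h_pos i (Finset.mem_Icc.1 hi).1) (Finset.nonempty_Icc.2 hk)

theorem mainTheorem2_general (H : ℕ → ℝ) (n T : ℕ) (hH : ∀ s ∈ Finset.Icc 1 (T - 1), 0 < H s)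
    (hT : 3 ≤ T) (hn : n ≤ T - 1) :
    ∑ s ∈ Finset.Icc 1 (T - 1), (-1 : ℝ) ^ (s + 1) * racahR n s T * H s <
      ∑ s ∈ Finset.Icc 1 (T - 1), H s := by
  have term_le (s : ℕ) (hs : s ∈ Finset.Icc 1 (T - 1)) :
      (-1 : ℝ) ^ (s + 1) * racahR n s T * H s ≤ H s := by
    have s_le := (Finset.mem_Icc.1 hs).2
    refine mul_le_of_le_one_left (hH s hs).le ((le_abs_self _).trans ?_)
    rw [abs_mul, abs_neg_one_pow, one_mul]
    exact abs_racahR_le_one (by omega) (by omega)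
  refine Finset.sum_lt_sum term_le ?_
  rcases n.eq_zero_or_pos with rfl | n_pos
  · have mem : 2 ∈ Finset.Icc 1 (T - 1) := Finset.mem_Icc.2 (by omega)
    refine ⟨2, mem, mul_lt_of_lt_one_left (hH 2 mem) ?_⟩
    rw [racahR_zero_left]
    norm_num
  · have mem : 1 ∈ Finset.Icc 1 (T - 1) := Finset.mem_Icc.2 (by omega)
    refine ⟨1, mem, mul_lt_of_lt_one_left (hH 1 mem) ?_⟩
    rw [one_add_one_eq_two, neg_one_sq, one_mul]
    exact racahR_one_right_lt_one n_pos (by omega)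

theorem mainTheorem2 (H : ℕ → ℝ) (hH : IsConcaveIncreasing H) (n T : ℕ)
    (hT : 3 ≤ T) (hn : n ≤ T - 1) :
    ∑ s ∈ Finset.Icc 1 (T - 1), (-1 : ℝ) ^ (s + 1) * racahR n s T * H s <
      ∑ s ∈ Finset.Icc 1 (T - 1), H s :=
  mainTheorem2_general H n T (fun _ hs => hH.pos (Finset.mem_Icc.1 hs).1) hT hn
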